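/- Let $G_2=\bigoplus_{n=1}^{\infty}\mathbb Z/2\mathbb Z$, a countable discrete abelian group. A set $S\subseteq G_2$ is a *set of topological recurrence* if for every action $T$ of $G_2$ by homeomorphisms on a compact metric space $X$ that is minimal (every orbit $\{T^gx:g\in G_2\}$ is dense in $X$) and every nonempty open $U\subseteq X$, there is $g\in S$ with $U\cap T^gU\neq\varnothing$. A set $S\subseteq G_2$ is a *set of measurable recurrence* if for every measure preserving action $T$ of $G_2$ on a probability measure space $(X,\mu)$ and every measurable $D\subseteq X$ with $\mu(D)>0$, there is $g\in S$ with $\mu(D\cap T^gD)>0$. **Theorem.** There is a set $S\subseteq G_2$ such that for every $g\in G_2$ the translate $S+g=\{s+g:s\in S\}$ is a set of topological recurrence, while $S$ is not a set of measurable recurrence. -/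

import Mathlib

open scoped DirectSum Pointwise

universe u v

/-- The countable direct sum of copies of `ℤ/2ℤ`. -/
abbrev G2 : Type := ⨁ _ : ℕ, ZMod 2

/-- `S` is a set of measurable recurrence: for every measure preserving action `T` of `G` on a
probability space `(X, μ)` and every measurable `D` with `μ D > 0`, there is `g ∈ S` such that
`μ (D ∩ T^g D) > 0`. The set `T^g D` is the pointwise image `g +ᵥ D`. -/
def IsSetOfMeasurableRecurrence {G : Type v} [AddCommGroup G] (S : Set G) : Prop :=
  ∀ (X : Type u) [MeasurableSpace X] (μ : MeasureTheory.Measure X)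
    [MeasureTheory.IsProbabilityMeasure μ] [AddAction G X] [MeasurableConstVAdd G X]
    [MeasureTheory.VAddInvariantMeasure G X μ] (D : Set X),
    MeasurableSet D → 0 < μ D → ∃ g ∈ S, 0 < μ (D ∩ (g +ᵥ D))

/-- `S` is a set of topological recurrence: for every minimal action `T` of `G` by homeomorphisms
on a compact metric space `X` and every nonempty open `U`, there is `g ∈ S` such that
`U ∩ T^g U` is nonempty. (Each `T^g` is continuous with continuous inverse `T^(-g)`.) -/
def IsSetOfTopologicalRecurrence {G : Type v} [AddCommGroup G] (S : Set G) : Prop :=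
  ∀ (X : Type u) [MetricSpace X] [CompactSpace X] [AddAction G X] [ContinuousConstVAdd G X]
    [AddAction.IsMinimal G X] (U : Set X),
    IsOpen U → U.Nonempty → ∃ g ∈ S, (U ∩ (g +ᵥ U)).Nonempty

/-! Two opposing facts about the vectors of weight at least n - k in (ℤ/2)^n drive the construction.
For colourings they are unavoidable: by Tucker's lemma, every k-colouring of the cube has two
vertices of one colour that agree in at most k coordinates (`exists_nearly_antipodal`). For density
they are easy to avoid: when n is suitably large, almost every vector is light or heavy (weight off
n/2 by more than k/2), and adding a vector of weight at least n - k never joins two light or two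
heavy vectors.

The set S is an increasing union. For each pair (g, k), some stage adds g + v for all v of weight at
least n - k in a fresh block of coordinates. Since g + g = 0, the translate S + g contains these v,
and `isSetOfTopologicalRecurrence_of_coloring` applies. To keep the stage avoidable
(`HasModel.extend`), a set D in a finite quotient is replaced by D × light ∪ (D + π g + π t) ×
heavy, where t is a fixed element already avoided. A return under g + v must switch between the two
pieces, and this would give a difference π t inside D. The density lost at each stage is small
enough to stay above 1/4. A weak limit of shift-invariant measures built from the finite models then
defeats measurable recurrence for all of S at once (`not_isSetOfMeasurableRecurrence`). -/

/-! ### Signed labels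

The natural number `2 * j` stands for the label `+j` and `2 * j + 1` for `-j`. -/

/-- Change the sign of a label. -/
def flipLabel (a : ℕ) : ℕ := 2 * (a / 2) + (1 - a % 2)

theorem flipLabel_flipLabel (a : ℕ) : flipLabel (flipLabel a) = a := by
  unfold flipLabel; omega

/-- The indicator of the lists of labels whose signs alternate, beginning with `s`. -/
def altList : Bool → List ℕ → ZMod 2
  | _, [] => 1
  | s, a :: l => if decide (a % 2 = 0) = s then altList (!s) l else 0

theorem altList_map_flipLabel (l : List ℕ) : ∀ s, altList s (l.map flipLabel) = altList (!s) l := by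
  induction l with
  | nil => intro s; rfl
  | cons a l ih =>
    intro s
    have h : decide (flipLabel a % 2 = 0) = !decide (a % 2 = 0) := by
      unfold flipLabel
      rcases Nat.mod_two_eq_zero_or_one a with h | h <;> simp [h, Nat.add_mod]
    simp only [List.map_cons, altList, ih, h]
    cases s <;> cases decide (a % 2 = 0) <;> simp

/-- If the head has sign `s`, erasing it contributes `altList s l`, which cancels mod 2 against one
of the two terms given by induction on the tail; otherwise only erasing the head can contribute.
Sortedness makes equal labels adjacent, so erasing by value is harmless. -/
theorem sum_altList_erase (l : List ℕ) (hl : l.Pairwise (· ≤ ·)) :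
    ∀ s, (l.map fun x => altList s (l.erase x)).sum = altList s l + altList (!s) l := by
  induction l with
  | nil => intro s; exact (CharTwo.add_self_eq_zero (1 : ZMod 2)).symm
  | cons e l ih =>
    intro s
    rw [List.pairwise_cons] at hl
    have h : ∀ x ∈ l, (e :: l).erase x = e :: l.erase x := by
      intro x hx
      by_cases hxe : e = x
      · subst hxe
        obtain ⟨b, t, rfl⟩ := List.exists_cons_of_ne_nil (List.ne_nil_of_mem hx)
        have : b = e := by
          rcases List.mem_cons.1 hx with h | h
          · exact h.symm
          · exact le_antisymm ((List.pairwise_cons.1 hl.2).1 _ h) (hl.1 _ (by simp))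
        simp [this]
      · rw [List.erase_cons_tail (by simpa using hxe)]
    rw [List.map_cons, List.sum_cons, List.erase_cons_head,
      List.map_congr_left (fun x hx => by rw [h x hx])]
    have ih' := ih hl.2 (!s)
    rw [Bool.not_not] at ih'
    have h2 : ∀ z : ZMod 2, z + z = 0 := CharTwo.add_self_eq_zero
    by_cases hs : decide (e % 2 = 0) = s
    · simp only [altList, hs, if_true, ih', Bool.not_not, Bool.eq_not_self, if_false, add_zero]
      rw [add_comm, add_assoc, h2, add_zero]
    · have hs' : decide (e % 2 = 0) = !s := by
        cases s <;> cases h : decide (e % 2 = 0) <;> simp_all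
      simp [altList, hs']

/-- Consecutive labels have opposite signs, so equal absolute values would form a forbidden pair of
opposite labels. -/
theorem isChain_of_altList_ne_zero (l : List ℕ) (hl : l.Pairwise (· ≤ ·))
    (hg : ∀ a ∈ l, flipLabel a ∉ l) :
    ∀ s, altList s l ≠ 0 → (l.map (· / 2)).IsChain (· < ·) := by
  induction l with
  | nil => intro s _; simp
  | cons a l ih =>
    intro s h
    rw [List.pairwise_cons] at hl
    have hs : decide (a % 2 = 0) = s := by by_contra hs; simp [altList, hs] at h
    simp only [altList, hs, if_true] at h
    have ih' := ih hl.2 (fun a ha h => hg a (by simp [ha]) (by simp [h])) _ h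
    cases l with
    | nil => simp
    | cons b t =>
      simp only [List.map_cons, List.isChain_cons_cons] at ih' ⊢
      refine ⟨?_, ih'⟩
      have hb : decide (b % 2 = 0) = !s := by by_contra hs; simp [altList, hs] at h
      have hab := hl.1 b (by simp)
      have hf : flipLabel a ≠ b := fun h => hg a (by simp) (by simp [h])
      have hne : a % 2 ≠ b % 2 := by
        intro h; rw [h, hb] at hs; simp at hs
      unfold flipLabel at hf
      omega

/-- The indicator of the multisets of labels whose signs alternate in increasing order, beginning
with `s`. -/
def altMultiset (s : Bool) (m : Multiset ℕ) : ZMod 2 := altList s (m.sort (· ≤ ·))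

/-- The mod 2 coboundary of a function of multisets. -/
def labelCoboundary (φ : Multiset ℕ → ZMod 2) (m : Multiset ℕ) : ZMod 2 :=
  (m.map fun x => φ (m.erase x)).sum

theorem labelCoboundary_cons (φ : Multiset ℕ → ZMod 2) (a : ℕ) (m : Multiset ℕ) :
    labelCoboundary φ (a ::ₘ m) = φ m + labelCoboundary (fun m => φ (a ::ₘ m)) m := by
  unfold labelCoboundary
  rw [Multiset.map_cons, Multiset.sum_cons, Multiset.erase_cons_head]
  congr 2
  refine Multiset.map_congr rfl fun x hx => ?_
  by_cases h : a = x
  · subst h; simp only [Multiset.erase_cons_head, Multiset.cons_erase hx]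
  · rw [Multiset.erase_cons_tail _ h]

theorem labelCoboundary_altMultiset (s : Bool) (m : Multiset ℕ) :
    labelCoboundary (altMultiset s) m = altMultiset s m + altMultiset (!s) m := by
  unfold altMultiset
  rw [← sum_altList_erase _ (Multiset.pairwise_sort m (· ≤ ·))]
  unfold labelCoboundary
  conv_lhs => rw [← Multiset.sort_eq m (· ≤ ·)]
  rw [Multiset.map_coe, Multiset.sum_coe]
  congr 1
  refine List.map_congr_left fun x _ => congrArg (altList s) ?_
  refine List.Perm.eq_of_pairwise (le := (· ≤ ·)) (fun a b _ _ h h' => le_antisymm h h')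
    (Multiset.pairwise_sort _ _) ((Multiset.pairwise_sort m _).sublist List.erase_sublist) ?_
  rw [← Multiset.coe_eq_coe, Multiset.sort_eq, Multiset.coe_erase]

/-- Flipping reverses the order only within a pair `2 * j`, `2 * j + 1`, and `hm` excludes such
pairs; so it commutes with sorting. -/
theorem altMultiset_map_flipLabel (s : Bool) (m : Multiset ℕ) (hm : ∀ a ∈ m, flipLabel a ∉ m) :
    altMultiset s (m.map flipLabel) = altMultiset (!s) m := by
  unfold altMultiset
  rw [← altList_map_flipLabel]
  congr 1
  symm
  refine Multiset.map_sort (f := flipLabel) (r := (· ≤ ·)) (r' := (· ≤ ·)) m fun a ha b hb => ?_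
  have h1 : flipLabel a ≠ b := fun h => hm a ha (h ▸ hb)
  unfold flipLabel at *
  omega

theorem card_le_of_altMultiset_ne_zero (s : Bool) (m : Multiset ℕ) (hm : ∀ a ∈ m, flipLabel a ∉ m)
    (h : altMultiset s m ≠ 0) {N : ℕ} (hN : ∀ a ∈ m, a < 2 * N) : m.card ≤ N := by
  have h1 := isChain_of_altList_ne_zero (m.sort (· ≤ ·)) (Multiset.pairwise_sort _ _)
    (by simpa using hm) s h
  have h2 : ((m.sort (· ≤ ·)).map (· / 2)).Nodup := by
    rw [List.isChain_iff_pairwise] at h1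
    exact h1.imp (fun h => h.ne)
  have h3 : ((m.sort (· ≤ ·)).map (· / 2)).toFinset ⊆ Finset.range N := by
    intro x hx
    simp only [List.mem_toFinset, List.mem_map, Multiset.mem_sort] at hx
    obtain ⟨a, ha, rfl⟩ := hx
    have := hN a ha
    simp only [Finset.mem_range]; omega
  have h4 := Finset.card_le_card h3
  rw [List.toFinset_card_of_nodup h2] at h4
  simpa using h4

/-! ### Tucker's lemma -/

section Tucker

variable {n : ℕ} (lam : (Fin n → SignType) → ℕ)

/-- The sum of `φ`, evaluated at the labels, over the flags of length `d` that descend from the sign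
vector `X` by deleting one nonzero coordinate at a time. -/
def flagSum : ℕ → (Fin n → SignType) → (Multiset ℕ → ZMod 2) → ZMod 2
  | 0, _, φ => φ 0
  | d + 1, X, φ => ∑ i with X i ≠ 0, flagSum d (Function.update X i 0) fun m => φ (lam X ::ₘ m)

theorem flagSum_add (d : ℕ) : ∀ (X : Fin n → SignType) (φ ψ : Multiset ℕ → ZMod 2),
    flagSum lam d X (fun m => φ m + ψ m) = flagSum lam d X φ + flagSum lam d X ψ := by
  induction d with
  | zero => intro X φ ψ; rfl
  | succ d ih => intro X φ ψ; simp only [flagSum, ih, Finset.sum_add_distrib]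

/-- Two coordinates can be deleted in either order: this is ∂∂ = 0 mod 2. -/
theorem sum_sum_update_eq_zero (f : (Fin n → SignType) → ZMod 2) (X : Fin n → SignType) :
    ∑ i with X i ≠ 0, ∑ j with Function.update X i 0 j ≠ 0,
      f (Function.update (Function.update X i 0) j 0) = 0 := by
  rw [Finset.sum_sigma']
  refine Finset.sum_involution (fun p _ => ⟨p.2, p.1⟩) ?_ ?_ ?_ ?_
  · rintro ⟨i, j⟩ h
    simp only [Finset.mem_sigma, Finset.mem_filter_univ] at h
    have hij : i ≠ j := by rintro rfl; simp at h
    simp only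
    rw [Function.update_comm hij]
    exact CharTwo.add_self_eq_zero _
  · rintro ⟨i, j⟩ h _ he
    simp only [Finset.mem_sigma, Finset.mem_filter_univ] at h
    simp only [Sigma.mk.injEq] at he
    rw [he.1] at h; simp at h
  · rintro ⟨i, j⟩ h
    simp only [Finset.mem_sigma, Finset.mem_filter_univ] at h ⊢
    have hij : i ≠ j := by rintro rfl; simp at h
    rw [Function.update_of_ne hij.symm] at h
    rw [Function.update_of_ne hij]
    exact h.symm
  · rintro ⟨i, j⟩ _; rfl

/-- Stokes' formula mod 2: omitting any member of a flag except the top one cancels in pairs, so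
only the omission of `X` survives. -/
theorem flagSum_labelCoboundary (d : ℕ) : ∀ (X : Fin n → SignType) (φ : Multiset ℕ → ZMod 2),
    flagSum lam (d + 1) X (labelCoboundary φ) =
      ∑ i with X i ≠ 0, flagSum lam d (Function.update X i 0) φ := by
  induction d with
  | zero => intro X φ; simp [flagSum, labelCoboundary]
  | succ d ih =>
    intro X φ
    rw [flagSum]
    simp only [labelCoboundary_cons, flagSum_add, Finset.sum_add_distrib, ih]
    rw [sum_sum_update_eq_zero (fun Y => flagSum lam d Y fun m => φ (lam X ::ₘ m)), add_zero]

variable {lam}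

/-- `Y` arises from `X` by deleting coordinates. -/
def SignLE (Y X : Fin n → SignType) : Prop := ∀ i, Y i ≠ 0 → Y i = X i

theorem SignLE.trans_update {Y X : Fin n → SignType} {i : Fin n}
    (h : SignLE Y (Function.update X i 0)) : SignLE Y X := by
  intro j hj
  have := h j hj
  by_cases hij : j = i
  · subst hij; simp at this; exact absurd this hj
  · rwa [Function.update_of_ne hij] at this

/-- Members of a flag are comparable under `SignLE`, so by `hanti` their labels never contain an
opposite pair; only such multisets matter. -/
theorem flagSum_congr (hanti : ∀ X Y, X ≠ 0 → SignLE X Y → lam Y ≠ flipLabel (lam X)) (d : ℕ) :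
    ∀ (X : Fin n → SignType) (φ ψ : Multiset ℕ → ZMod 2),
      (∀ m, m.card = d → (∀ a ∈ m, ∃ Y, Y ≠ 0 ∧ SignLE Y X ∧ a = lam Y) →
        (∀ a ∈ m, flipLabel a ∉ m) → φ m = ψ m) →
      flagSum lam d X φ = flagSum lam d X ψ := by
  induction d with
  | zero => intro X φ ψ h; exact h 0 rfl (by simp) (by simp)
  | succ d ih =>
    intro X φ ψ h
    rw [flagSum, flagSum]
    refine Finset.sum_congr rfl fun i hi => ih _ _ _ fun m hc hm hg => h _ (by simp [hc]) ?_ ?_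
    · intro a ha
      rcases Multiset.mem_cons.1 ha with rfl | ha
      · refine ⟨X, ?_, fun _ _ => rfl, rfl⟩
        rintro rfl; simp at hi
      · obtain ⟨Y, hY, hle, rfl⟩ := hm a ha
        exact ⟨Y, hY, hle.trans_update, rfl⟩
    · have hne : ∀ a ∈ m, lam X ≠ flipLabel a := by
        intro a ha
        obtain ⟨Y, hY, hle, rfl⟩ := hm a ha
        exact hanti Y X hY hle.trans_update
      intro a ha hf
      rcases Multiset.mem_cons.1 ha with rfl | ha
      · rcases Multiset.mem_cons.1 hf with hf | hf
        · unfold flipLabel at hf; omega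
        · exact hne _ hf (flipLabel_flipLabel _).symm
      · rcases Multiset.mem_cons.1 hf with hf | hf
        · exact hne a ha hf.symm
        · exact hg a ha hf

theorem flagSum_neg (hodd : ∀ X, X ≠ 0 → lam (-X) = flipLabel (lam X)) (d : ℕ) :
    ∀ (X : Fin n → SignType) (φ : Multiset ℕ → ZMod 2),
      flagSum lam d (-X) φ = flagSum lam d X fun m => φ (m.map flipLabel) := by
  induction d with
  | zero => intro X φ; simp [flagSum]
  | succ d ih =>
    intro X φ
    rw [flagSum, flagSum]
    refine Finset.sum_congr (by ext i; simp) fun i hi => ?_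
    have hX : X ≠ 0 := by rintro rfl; simp at hi
    have : Function.update (-X) i 0 = -Function.update X i 0 := by
      ext j; by_cases hj : j = i
      · subst hj; simp
      · simp [Function.update_of_ne hj]
    rw [this, ih]
    simp only [hodd X hX, Multiset.map_cons]

/-- The sign vectors whose support is the set of the first `d` coordinates. -/
def initialVectors (n d : ℕ) : Finset (Fin n → SignType) := {X | ∀ i, X i ≠ 0 ↔ (i : ℕ) < d}

theorem mem_initialVectors {d : ℕ} {X : Fin n → SignType} :
    X ∈ initialVectors n d ↔ ∀ i, X i ≠ 0 ↔ (i : ℕ) < d := by simp [initialVectors]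

/-- The boundary of a hemisphere is the equator: a face obtained by deleting a coordinate below `d`
is shared by two vectors and cancels. -/
theorem sum_positive_update (d : ℕ) (hd : d < n) (f : (Fin n → SignType) → ZMod 2) :
    ∑ X ∈ initialVectors n (d + 1) with X ⟨d, hd⟩ = 1,
      ∑ i with X i ≠ 0, f (Function.update X i 0) = ∑ X ∈ initialVectors n d, f X := by
  have h1 : ∀ X ∈ (initialVectors n (d + 1)).filter (fun X => X ⟨d, hd⟩ = 1),
      ∑ i with X i ≠ 0, f (Function.update X i 0) =
        f (Function.update X ⟨d, hd⟩ 0) +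
          ∑ i ∈ Finset.univ.filter (fun i : Fin n => (i : ℕ) < d), f (Function.update X i 0) := by
    intro X hX
    rw [Finset.mem_filter, mem_initialVectors] at hX
    rw [← Finset.sum_insert (s := Finset.univ.filter (fun i : Fin n => (i : ℕ) < d))
      (f := fun i => f (Function.update X i 0)) (by simp)]
    refine Finset.sum_congr ?_ fun _ _ => rfl
    ext i
    simp only [Finset.mem_filter_univ, Finset.mem_insert, hX.1 i, Fin.ext_iff]
    omega
  rw [Finset.sum_congr rfl h1, Finset.sum_add_distrib, Finset.sum_comm]
  have h2 : ∀ i ∈ Finset.univ.filter (fun i : Fin n => (i : ℕ) < d),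
      ∑ X ∈ initialVectors n (d + 1) with X ⟨d, hd⟩ = 1, f (Function.update X i 0) = 0 := by
    intro i hi
    rw [Finset.mem_filter_univ] at hi
    have hid : (⟨d, hd⟩ : Fin n) ≠ i := by rintro rfl; simp at hi
    refine Finset.sum_involution (fun X _ => Function.update X i (-X i)) ?_ ?_ ?_ ?_
    · intro X _
      simp only [Function.update_idem]
      exact CharTwo.add_self_eq_zero _
    · intro X hX _ he
      rw [Finset.mem_filter, mem_initialVectors] at hX
      have h0 : X i ≠ 0 := (hX.1 i).2 (by omega)
      have := congrFun he i
      rw [Function.update_self] at this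
      revert this h0
      cases X i <;> decide
    · intro X hX
      simp only [Finset.mem_filter, mem_initialVectors] at hX ⊢
      refine ⟨fun j => ?_, by rw [Function.update_of_ne hid]; exact hX.2⟩
      by_cases hj : j = i
      · subst hj; simpa using hX.1 j
      · rw [Function.update_of_ne hj]; exact hX.1 j
    · intro X _; simp
  rw [Finset.sum_eq_zero h2, add_zero]
  refine Finset.sum_bij' (fun X _ => Function.update X ⟨d, hd⟩ 0)
    (fun X _ => Function.update X ⟨d, hd⟩ 1) ?_ ?_ ?_ ?_ ?_
  · intro X hX
    simp only [Finset.mem_filter, mem_initialVectors] at hX ⊢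
    intro j
    by_cases hj : j = ⟨d, hd⟩
    · subst hj; simp
    · rw [Function.update_of_ne hj, hX.1 j]
      have : (j : ℕ) ≠ d := fun h => hj (Fin.ext h)
      omega
  · intro X hX
    simp only [Finset.mem_filter, mem_initialVectors] at hX ⊢
    refine ⟨fun j => ?_, by simp⟩
    by_cases hj : j = ⟨d, hd⟩
    · subst hj; simp
    · rw [Function.update_of_ne hj, hX j]
      have : (j : ℕ) ≠ d := fun h => hj (Fin.ext h)
      omega
  · intro X hX
    simp only [Finset.mem_filter] at hX
    simp [← hX.2]
  · intro X hX
    rw [mem_initialVectors] at hX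
    have : X ⟨d, hd⟩ = 0 := by
      by_contra h; simpa using (hX _).1 h
    simp [← this]
  · intro X _; rfl

/-- Induction on dimension. The antipodal map moves the negative hemisphere to the positive one and
switches the starting sign. The two alternating indicators then add up to a coboundary, which Stokes
reduces to the equator. -/
theorem sum_flagSum_altMultiset (hodd : ∀ X, X ≠ 0 → lam (-X) = flipLabel (lam X))
    (hanti : ∀ X Y, X ≠ 0 → SignLE X Y → lam Y ≠ flipLabel (lam X)) (d : ℕ) (hd : d ≤ n) :
    ∑ X ∈ initialVectors n d, flagSum lam d X (altMultiset true) = 1 := by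
  induction d with
  | zero =>
    have : initialVectors n 0 = {0} := by
      ext X
      simp only [mem_initialVectors, Finset.mem_singleton, funext_iff]
      simp
    rw [this, Finset.sum_singleton]
    simp [flagSum, altMultiset, altList]
  | succ d ih =>
    rw [← ih (by omega)]
    have hd' : d < n := hd
    rw [← sum_positive_update d hd',
      ← Finset.sum_filter_add_sum_filter_not _ (fun X : Fin n → SignType => X ⟨d, hd'⟩ = 1)]
    have hneg : ∑ X ∈ initialVectors n (d + 1) with ¬ X ⟨d, hd'⟩ = 1,
        flagSum lam (d + 1) X (altMultiset true) =
        ∑ X ∈ initialVectors n (d + 1) with X ⟨d, hd'⟩ = 1,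
          flagSum lam (d + 1) X (altMultiset false) := by
      refine Finset.sum_bij' (fun X _ => -X) (fun X _ => -X) ?_ ?_ ?_ ?_ ?_
      · intro X hX
        simp only [Finset.mem_filter, mem_initialVectors] at hX ⊢
        refine ⟨fun i => by simpa using hX.1 i, ?_⟩
        have h0 : X ⟨d, hd'⟩ ≠ 0 := (hX.1 _).2 (by simp)
        have h1 := hX.2
        rw [Pi.neg_apply]
        revert h0 h1
        cases X ⟨d, hd'⟩ <;> decide
      · intro X hX
        simp only [Finset.mem_filter, mem_initialVectors] at hX ⊢
        refine ⟨fun i => by simpa using hX.1 i, ?_⟩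
        rw [Pi.neg_apply, hX.2]; decide
      · intro X _; exact neg_neg X
      · intro X _; exact neg_neg X
      · intro X _
        conv_lhs => rw [← neg_neg X]
        rw [flagSum_neg hodd]
        refine flagSum_congr hanti _ _ _ _ fun m _ _ hg => ?_
        exact altMultiset_map_flipLabel true m hg
    rw [hneg, ← Finset.sum_add_distrib]
    refine Finset.sum_congr rfl fun X _ => ?_
    rw [← flagSum_add, ← flagSum_labelCoboundary]
    congr 1
    funext m
    exact (labelCoboundary_altMultiset true m).symm

/-- **Tucker's lemma** for the barycentric subdivision of the boundary of the cross-polytope. -/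
theorem tucker (hodd : ∀ X, X ≠ 0 → lam (-X) = flipLabel (lam X))
    (hanti : ∀ X Y, X ≠ 0 → SignLE X Y → lam Y ≠ flipLabel (lam X)) {N : ℕ}
    (hN : ∀ X, X ≠ 0 → lam X < 2 * N) : n ≤ N := by
  by_contra hlt
  have h := sum_flagSum_altMultiset hodd hanti n le_rfl
  rw [Finset.sum_eq_zero] at h
  · exact zero_ne_one h
  intro X _
  -- An alternating flag of length `n` would need `n` distinct absolute values among only `N < n`.
  have : flagSum lam n X (altMultiset true) = flagSum lam n X (fun _ => 0) := by
    refine flagSum_congr hanti _ _ _ _ fun m hc hm hg => ?_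
    by_contra h0
    have := card_le_of_altMultiset_ne_zero true m hg h0 (N := N) (by
      intro a ha
      obtain ⟨Y, hY, _, rfl⟩ := hm a ha
      exact hN Y hY)
    omega
  rw [this]
  have h0 : ∀ d (X : Fin n → SignType), flagSum lam d X (fun _ => 0) = 0 := by
    intro d
    induction d with
    | zero => intro X; rfl
    | succ d ih => intro X; simp [flagSum, ih]
  exact h0 n X

end Tucker

/-! ### Colourings of the cube -/

section Cube

variable {n : ℕ}

/-- The first nonzero coordinate of `X` is positive. -/
def FirstPositive (X : Fin n → SignType) : Prop := ∃ i, X i = 1 ∧ ∀ j < i, X j = 0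

theorem firstPositive_neg {X : Fin n → SignType} (hX : X ≠ 0) :
    FirstPositive (-X) ↔ ¬ FirstPositive X := by
  obtain ⟨i, hi, hmin⟩ : ∃ i, X i ≠ 0 ∧ ∀ j < i, X j = 0 := by
    obtain ⟨i, hi, hmin⟩ := wellFounded_lt.has_min {i | X i ≠ 0} (Function.ne_iff.1 hX)
    exact ⟨i, hi, fun j hj => by_contra fun h => hmin j h hj⟩
  have key : ∀ Y : Fin n → SignType, Y i ≠ 0 → (∀ j < i, Y j = 0) →
      (FirstPositive Y ↔ Y i = 1) := by
    intro Y hY hm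
    refine ⟨?_, fun h => ⟨i, h, hm⟩⟩
    rintro ⟨i', h1, h2⟩
    rcases lt_trichotomy i i' with h | h | h
    · exact absurd (h2 i h) hY
    · rwa [h]
    · rw [hm i' h] at h1; exact absurd h1 (by decide)
  rw [key X hi hmin, key (-X) (by simpa using hi) (fun j hj => by simp [hmin j hj]), Pi.neg_apply]
  revert hi
  cases X i <;> decide

/-- The number of nonzero coordinates of a sign vector. -/
def suppCard (X : Fin n → SignType) : ℕ := (Finset.univ.filter fun i => X i ≠ 0).card

theorem suppCard_neg (X : Fin n → SignType) : suppCard (-X) = suppCard X := by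
  simp [suppCard]

theorem suppCard_pos {X : Fin n → SignType} (hX : X ≠ 0) : 0 < suppCard X := by
  obtain ⟨i, hi⟩ := Function.ne_iff.1 hX
  exact Finset.card_pos.2 ⟨i, by simpa using hi⟩

theorem SignLE.suppCard_le {X Y : Fin n → SignType} (h : SignLE X Y) : suppCard X ≤ suppCard Y :=
  Finset.card_le_card fun i hi => by
    rw [Finset.mem_filter_univ] at hi ⊢
    rwa [← h i hi]

theorem SignLE.eq_of_suppCard_eq {X Y : Fin n → SignType} (h : SignLE X Y)
    (hc : suppCard X = suppCard Y) : X = Y := by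
  have hs : (Finset.univ.filter fun i => X i ≠ 0) = Finset.univ.filter fun i => Y i ≠ 0 :=
    Finset.eq_of_subset_of_card_le (fun i hi => by
      rw [Finset.mem_filter_univ] at hi ⊢
      rwa [← h i hi]) hc.ge
  ext i
  by_cases hi : X i = 0
  · have : ¬ Y i ≠ 0 := fun hY => by
      have : i ∈ Finset.univ.filter fun i => X i ≠ 0 := by rw [hs]; simpa using hY
      simp [hi] at this
    rw [hi, not_not.1 this]
  · rw [h i hi]

/-- The vertex of the cube obtained from a sign vector by replacing zeros with `+`. -/
def cubeVertex (X : Fin n → SignType) (i : Fin n) : ZMod 2 := if X i = -1 then 0 else 1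

theorem SignLE.card_agree_le {X Y : Fin n → SignType} (h : SignLE X Y) :
    (Finset.univ.filter fun i => cubeVertex X i = cubeVertex (-Y) i).card + suppCard X ≤ n := by
  have hd : Disjoint (Finset.univ.filter fun i => cubeVertex X i = cubeVertex (-Y) i)
      (Finset.univ.filter fun i => X i ≠ 0) := by
    rw [Finset.disjoint_left]
    intro i hi h0
    rw [Finset.mem_filter_univ] at hi h0
    have := h i h0
    unfold cubeVertex at hi
    rw [Pi.neg_apply, ← this] at hi
    revert hi h0
    cases X i <;> decide
  rw [suppCard, ← Finset.card_union_of_disjoint hd]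
  simpa using Finset.card_le_univ
    ((Finset.univ.filter fun i => cubeVertex X i = cubeVertex (-Y) i) ∪
      Finset.univ.filter fun i => X i ≠ 0)

open Classical in
/-- The labelling of the sign vectors attached to a colouring of the cube. -/
noncomputable def cubeLabel {k : ℕ} (f : (Fin n → ZMod 2) → Fin k) (X : Fin n → SignType) : ℕ :=
  -- Small supports use the absolute values `0, …, n - k - 2`; large ones use `n - 1 - k` plus the
  -- larger of two colours, hence at most `n - 2`. Only `n - 1` values occur, one too few for
  -- Tucker's lemma.
  if suppCard X + k + 1 ≤ n then 2 * (suppCard X - 1) + if FirstPositive X then 0 else 1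
  else if (f (cubeVertex (-X)) : ℕ) < f (cubeVertex X) then
    2 * (n - 1 - k + f (cubeVertex X))
  else 2 * (n - 1 - k + f (cubeVertex (-X))) + 1

/-- In a colouring of the cube by `k` colours there are two vertices of the same colour that agree
in at most `k` coordinates. -/
theorem exists_nearly_antipodal {k : ℕ} (f : (Fin n → ZMod 2) → Fin k) :
    ∃ x y, f x = f y ∧ (Finset.univ.filter fun i => x i = y i).card ≤ k := by
  by_contra! H
  have hkn : k < n := by simpa using H 0 0 rfl
  -- For large supports an opposite pair of labels would equate the colours of nearly antipodal
  -- vertices, which `H` forbids.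
  have hne : ∀ X Y : Fin n → SignType, SignLE X Y → n ≤ suppCard X + k →
      (f (cubeVertex X) : ℕ) ≠ f (cubeVertex (-Y)) := by
    intro X Y h hX he
    have h1 := H _ _ (Fin.ext he)
    have h2 := h.card_agree_le
    omega
  have hrefl : ∀ X : Fin n → SignType, SignLE X X := fun X i _ => rfl
  refine absurd (tucker (lam := cubeLabel f) (N := n - 1) ?_ ?_ ?_) (by omega)
  · intro X hX
    have h1 := hne X X (hrefl X)
    unfold cubeLabel flipLabel
    rw [suppCard_neg, neg_neg]
    by_cases hs : suppCard X + k + 1 ≤ n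
    · rw [if_pos hs, if_pos hs]
      by_cases hp : FirstPositive X
      · rw [if_pos hp, if_neg (by rw [firstPositive_neg hX]; exact not_not.2 hp)]; omega
      · rw [if_neg hp, if_pos (by rwa [firstPositive_neg hX])]; omega
    · rw [if_neg hs, if_neg hs]
      have := h1 (by omega)
      split_ifs <;> omega
  · intro X Y hX hXY he
    have hc := hXY.suppCard_le
    have h0 := suppCard_pos hX
    by_cases hX' : suppCard X + k + 1 ≤ n <;> by_cases hY' : suppCard Y + k + 1 ≤ n
    · have : X = Y := by
        refine hXY.eq_of_suppCard_eq ?_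
        unfold cubeLabel flipLabel at he
        rw [if_pos hX', if_pos hY'] at he
        split_ifs at he <;> omega
      subst this
      unfold flipLabel at he
      omega
    · unfold cubeLabel flipLabel at he
      rw [if_pos hX', if_neg hY'] at he
      split_ifs at he <;> omega
    · omega
    · have h1 := hne X Y hXY (by omega)
      have hneg : SignLE (-X) (-Y) := fun i hi => by
        rw [Pi.neg_apply, Pi.neg_apply, hXY i (by simpa using hi)]
      have h2 := hne (-X) (-Y) hneg (by rw [suppCard_neg]; omega)
      rw [neg_neg] at h2
      unfold cubeLabel flipLabel at he
      rw [if_neg hX', if_neg hY'] at he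
      split_ifs at he <;> omega
  · intro X hX
    have h1 := (f (cubeVertex X)).isLt
    have h2 := (f (cubeVertex (-X))).isLt
    have h0 := suppCard_pos hX
    unfold cubeLabel
    split_ifs <;> omega

end Cube

/-! ### Topological recurrence and colourings -/

/-- By minimality and compactness finitely many translates of `U` cover the space; colour `g` by one
that contains the orbit point `g +ᵥ x₀`. -/
theorem isSetOfTopologicalRecurrence_of_coloring {G : Type v} [AddCommGroup G] {S : Set G}
    (h : ∀ (k : ℕ) (f : G → Fin k), ∃ x, ∃ s ∈ S, f (x + s) = f x) :
    IsSetOfTopologicalRecurrence.{u} S := by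
  intro X _ _ _ _ _ U hU hne
  obtain ⟨t, ht⟩ := isCompact_univ.elim_finite_subcover (fun g : G => g +ᵥ U)
    (fun g => hU.vadd g) (by
      rw [(hU.iUnion_vadd G hne)])
  obtain ⟨x₀, -⟩ := hne
  have hcov : ∀ g : G, ∃ a : t, g +ᵥ x₀ ∈ (a : G) +ᵥ U := by
    intro g
    have := ht (Set.mem_univ (g +ᵥ x₀))
    simp only [Set.mem_iUnion] at this
    obtain ⟨a, ha, hm⟩ := this
    exact ⟨⟨a, ha⟩, hm⟩
  choose c hc using hcov
  obtain ⟨x, s, hs, he⟩ := h t.card fun g => t.equivFin (c g)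
  have he' : c (x + s) = c x := t.equivFin.injective he
  have h1 := hc x
  have h2 := hc (x + s)
  rw [he', Set.mem_vadd_set_iff_neg_vadd_mem] at h2
  rw [Set.mem_vadd_set_iff_neg_vadd_mem] at h1
  refine ⟨s, hs, _, h2, ?_⟩
  rw [Set.mem_vadd_set_iff_neg_vadd_mem]
  convert h1 using 1
  simp only [vadd_vadd]
  congr 1
  abel

/-- The embedding of `(ℤ/2ℤ)^n` in `G2` as the block of coordinates `[M, M + n)`. -/
def blockEmbed (M n : ℕ) (v : Fin n → ZMod 2) : G2 :=
  ∑ i : Fin n, DirectSum.of (fun _ : ℕ => ZMod 2) (M + i) (v i)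

theorem blockEmbed_add (M n : ℕ) (v w : Fin n → ZMod 2) :
    blockEmbed M n (v + w) = blockEmbed M n v + blockEmbed M n w := by
  simp [blockEmbed, Finset.sum_add_distrib]

theorem blockEmbed_apply (M n : ℕ) (v : Fin n → ZMod 2) (j : ℕ) :
    blockEmbed M n v j = ∑ i : Fin n, if M + i = j then v i else 0 := by
  unfold blockEmbed
  rw [DFinsupp.finsetSum_apply]
  refine Finset.sum_congr rfl fun i _ => ?_
  rw [DirectSum.of_apply]
  split_ifs with h <;> simp_all

theorem blockEmbed_apply_add (M n : ℕ) (v : Fin n → ZMod 2) (i : Fin n) :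
    blockEmbed M n v (M + i) = v i := by
  rw [blockEmbed_apply, Finset.sum_eq_single i] <;> simp [Fin.ext_iff]
  intro b h1 h2; exact absurd h2 h1

theorem blockEmbed_apply_of_lt {M n j : ℕ} (v : Fin n → ZMod 2) (h : j < M) :
    blockEmbed M n v j = 0 := by
  rw [blockEmbed_apply]
  exact Finset.sum_eq_zero fun i _ => if_neg (by omega)

theorem blockEmbed_apply_of_le {M n j : ℕ} (v : Fin n → ZMod 2) (h : M + n ≤ j) :
    blockEmbed M n v j = 0 := by
  rw [blockEmbed_apply]
  exact Finset.sum_eq_zero fun i _ => if_neg (by have := i.isLt; omega)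

/-- The number of nonzero coordinates of a vector over `ZMod 2`. -/
def weight {n : ℕ} (v : Fin n → ZMod 2) : ℕ := (Finset.univ.filter fun i => v i ≠ 0).card

theorem exists_same_color_blockEmbed (M n k : ℕ) (f : G2 → Fin k) :
    ∃ x, ∃ v : Fin n → ZMod 2, n ≤ weight v + k ∧ f (x + blockEmbed M n v) = f x := by
  obtain ⟨x, y, hf, hc⟩ := exists_nearly_antipodal (fun v => f (blockEmbed M n v))
  refine ⟨blockEmbed M n x, x + y, ?_, ?_⟩
  · have h := Finset.card_filter_add_card_filter_not (s := Finset.univ) (fun i => x i = y i)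
    have hw : weight (x + y) = (Finset.univ.filter fun i => ¬ x i = y i).card := by
      unfold weight
      congr 1
      ext i
      simp only [Finset.mem_filter_univ, Pi.add_apply]
      generalize x i = a
      generalize y i = b
      revert a b
      decide
    rw [Finset.card_univ, Fintype.card_fin] at h
    omega
  · rw [← blockEmbed_add, ← add_assoc]
    have : x + x = 0 := funext fun i => CharTwo.add_self_eq_zero (x i)
    rw [this, zero_add]
    exact hf.symm

/-! ### Measurable recurrence and finite models -/

section Correspondence

open MeasureTheory Filter Topology

/-- The shift of a two-valued function on a group. -/
def shiftFun {G : Type} [AddCommGroup G] (g : G) (ω : G → Bool) : G → Bool := fun h => ω (h + g)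

theorem continuous_shiftFun {G : Type} [AddCommGroup G] (g : G) : Continuous (shiftFun g) :=
  continuous_pi fun h => continuous_apply (h + g)

/-- The shift action of a group on its two-valued functions. -/
abbrev shiftAction (G : Type) [AddCommGroup G] : AddAction G (G → Bool) where
  vadd := shiftFun
  zero_vadd ω := funext fun h => congrArg ω (add_zero h)
  add_vadd a b ω := funext fun h => congrArg ω (by abel)

/-- Push the uniform measure on `K` forward along the itinerary `x ↦ (h ↦ x + π h ∈ D)`; translation
invariance becomes shift invariance. -/
theorem exists_shiftInvariant {G K : Type} [AddCommGroup G] [Countable G] [AddCommGroup K]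
    [Fintype K] (π : G →+ K) (D : Set K) (hD : Fintype.card K ≤ 4 * D.ncard) :
    ∃ μ : ProbabilityMeasure (G → Bool),
      (∀ g, μ.map (continuous_shiftFun g).measurable.aemeasurable = μ) ∧
      1 / 4 ≤ μ {ω | ω 0 = true} ∧
      ∀ s, (∀ x ∈ D, x + π s ∉ D) → μ {ω | ω 0 = true ∧ ω (-s) = true} = 0 := by
  classical
  let _ : MeasurableSpace K := ⊤
  have hall : ∀ s : Set K, MeasurableSet s := fun _ => MeasurableSpace.measurableSet_top
  let ν : ProbabilityMeasure K :=
    ⟨ProbabilityTheory.uniformOn Set.univ,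
      ProbabilityTheory.isProbabilityMeasure_uniformOn Set.finite_univ Set.univ_nonempty⟩
  let Φ : K → G → Bool := fun x h => decide (x + π h ∈ D)
  have hΦ : Measurable Φ := measurable_from_top
  have hm : ∀ a b : G, MeasurableSet {ω : G → Bool | ω a = true ∧ ω b = true} := fun a b =>
    (measurableSet_eq_fun (measurable_pi_apply a) measurable_const).inter
      (measurableSet_eq_fun (measurable_pi_apply b) measurable_const)
  refine ⟨ν.map hΦ.aemeasurable, fun g => ?_, ?_, fun s hs => ?_⟩
  · apply Subtype.ext
    change Measure.map (shiftFun g) (Measure.map Φ (ν : Measure K)) = Measure.map Φ (ν : Measure K)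
    rw [Measure.map_map (continuous_shiftFun g).measurable hΦ]
    have h1 : shiftFun g ∘ Φ = Φ ∘ fun x => x + π g := by
      funext x h
      simp only [shiftFun, Φ, Function.comp, map_add]
      rw [add_assoc x, add_comm (π g)]
    rw [h1, ← Measure.map_map hΦ measurable_from_top]
    congr 1
    ext s _
    rw [Measure.map_apply measurable_from_top (hall _)]
    change ProbabilityTheory.uniformOn Set.univ _ = ProbabilityTheory.uniformOn Set.univ _
    rw [ProbabilityTheory.uniformOn_univ, ProbabilityTheory.uniformOn_univ,
      Measure.count_apply (hall _), Measure.count_apply (hall _)]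
    congr 2
    rw [← (add_left_injective (π g)).encard_image,
      Set.image_preimage_eq _ (add_right_surjective (π g))]
  · rw [ProbabilityMeasure.map_apply _ _ (by simpa using hm 0 0)]
    have h1 : Φ ⁻¹' {ω | ω 0 = true} = D := by ext x; simp [Φ]
    rw [h1, ← ENNReal.coe_le_coe, ProbabilityMeasure.ennreal_coeFn_eq_coeFn_toMeasure]
    change _ ≤ ProbabilityTheory.uniformOn Set.univ D
    rw [ProbabilityTheory.uniformOn_univ, Measure.count_apply (hall _),
      ENNReal.le_div_iff_mul_le (by simp) (by simp),
      ← Set.Finite.cast_ncard_eq D.toFinite]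
    have h4 : ((1 / 4 : NNReal) : ENNReal) = (4 : ENNReal)⁻¹ := by
      rw [one_div, ENNReal.coe_inv (by norm_num)]; rfl
    rw [h4, mul_comm, ← div_eq_mul_inv]
    refine ENNReal.div_le_of_le_mul' ?_
    exact_mod_cast hD
  · rw [ProbabilityMeasure.map_apply _ _ (hm 0 (-s))]
    have h1 : Φ ⁻¹' {ω | ω 0 = true ∧ ω (-s) = true} = ∅ := by
      ext x
      simp only [Φ, Set.mem_preimage, Set.mem_ofPred_eq, map_zero, add_zero, decide_eq_true_eq,
        map_neg, Set.mem_empty_iff_false, iff_false, not_and]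
      intro h0 h1
      exact hs _ h1 (by simpa using h0)
    rw [h1]; simp

/-- A set that is avoided by dense sets in finite quotients is not a set of measurable
recurrence. -/
theorem not_isSetOfMeasurableRecurrence {G : Type} [AddCommGroup G] [Countable G] {S : Set G}
    (h : ∃ T : ℕ → Set G, (∀ s ∈ S, ∀ᶠ i in atTop, s ∈ T i) ∧
      ∀ i, ∃ (K : Type) (_ : AddCommGroup K) (_ : Fintype K) (π : G →+ K) (D : Set K),
        Fintype.card K ≤ 4 * D.ncard ∧ ∀ s ∈ T i, ∀ x ∈ D, x + π s ∉ D) :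
    ¬ IsSetOfMeasurableRecurrence.{0} S := by
  obtain ⟨T, hT, hK⟩ := h
  have hμ : ∀ i, ∃ μ : ProbabilityMeasure (G → Bool),
      (∀ g, μ.map (continuous_shiftFun g).measurable.aemeasurable = μ) ∧
      1 / 4 ≤ μ {ω | ω 0 = true} ∧
      ∀ s ∈ T i, μ {ω | ω 0 = true ∧ ω (-s) = true} = 0 := by
    intro i
    obtain ⟨K, _, _, π, D, hc, hD⟩ := hK i
    obtain ⟨μ, h1, h2, h3⟩ := exists_shiftInvariant π D hc
    exact ⟨μ, h1, h2, fun s hs => h3 s (hD s hs)⟩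
  choose μ h1 h2 h3 using hμ
  -- Probability measures on the compact space of itineraries form a compact space. The events of
  -- interest are clopen, so their measures pass to the ultrafilter limit.
  obtain ⟨ν, -, hν⟩ := isCompact_univ.ultrafilter_le_nhds
    ((hyperfilter ℕ : Ultrafilter ℕ).map μ) (by simp)
  have hlim : Tendsto μ (hyperfilter ℕ : Filter ℕ) (𝓝 ν) := hν
  have hinv : ∀ g, ν.map (continuous_shiftFun g).measurable.aemeasurable = ν := by
    intro g
    have := ((ProbabilityMeasure.continuous_map (continuous_shiftFun g)).tendsto ν).comp hlim
    exact tendsto_nhds_unique this (hlim.congr fun i => (h1 i g).symm)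
  have hcl : ∀ a : G, IsClopen {ω : G → Bool | ω a = true} := fun a =>
    (isClopen_discrete {true}).preimage (continuous_apply a)
  have hpos : 1 / 4 ≤ ν {ω | ω 0 = true} :=
    ge_of_tendsto' (ProbabilityMeasure.tendsto_measure_of_isClopen_of_tendsto hlim (hcl 0)) h2
  have hzero : ∀ s ∈ S, ν {ω | ω 0 = true ∧ ω (-s) = true} = 0 := by
    intro s hs
    refine tendsto_nhds_unique
      (ProbabilityMeasure.tendsto_measure_of_isClopen_of_tendsto hlim ((hcl 0).inter (hcl (-s)))) ?_
    refine tendsto_const_nhds.congr' ?_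
    filter_upwards [Nat.hyperfilter_le_atTop (hT s hs)] with i hi
    exact (h3 i s hi).symm
  intro hS
  let _ := shiftAction G
  have : MeasurableConstVAdd G (G → Bool) :=
    ⟨fun g => (continuous_shiftFun g).measurable⟩
  have : VAddInvariantMeasure G (G → Bool) (ν : Measure (G → Bool)) := by
    refine ⟨fun g s hs => ?_⟩
    conv_rhs => rw [← hinv g]
    rw [ProbabilityMeasure.toMeasure_map, Measure.map_apply (continuous_shiftFun g).measurable hs]
    rfl
  obtain ⟨s, hs, hlt⟩ := hS (G → Bool) (ν : Measure (G → Bool)) {ω | ω 0 = true}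
    (hcl 0).isOpen.measurableSet (by
      rw [← ProbabilityMeasure.ennreal_coeFn_eq_coeFn_toMeasure]
      exact_mod_cast lt_of_lt_of_le (by norm_num) hpos)
  have he : {ω : G → Bool | ω 0 = true} ∩ (s +ᵥ {ω : G → Bool | ω 0 = true}) =
      {ω | ω 0 = true ∧ ω (-s) = true} := by
    ext ω
    rw [Set.mem_inter_iff, Set.mem_vadd_set_iff_neg_vadd_mem]
    change _ ∧ ω (0 + -s) = true ↔ _
    rw [zero_add]; rfl
  rw [he, ← ProbabilityMeasure.ennreal_coeFn_eq_coeFn_toMeasure, hzero s hs] at hlt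
  exact lt_irrefl _ hlt

end Correspondence

/-! ### Concentration of the weight -/

section Weight

variable {n : ℕ}

theorem weight_eq_sum (v : Fin n → ZMod 2) : weight v = ∑ i, if v i ≠ 0 then 1 else 0 :=
  Finset.card_filter _ _

theorem weight_le_add (a s : Fin n → ZMod 2) : weight s ≤ weight a + weight (a + s) := by
  simp only [weight_eq_sum, ← Finset.sum_add_distrib]
  refine Finset.sum_le_sum fun i _ => ?_
  rw [Pi.add_apply]
  generalize a i = x
  generalize s i = y
  revert x y
  decide

/-- In each coordinate at most two of `a`, `s`, `a + s` are nonzero. This rules out two heavy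
vectors differing by a nearly full one; `weight_le_add` rules out two light ones. -/
theorem weight_add_le_two_mul (a s : Fin n → ZMod 2) :
    weight s + weight a + weight (a + s) ≤ 2 * n := by
  have h : 2 * n = ∑ _ : Fin n, 2 := by simp [mul_comm]
  simp only [weight_eq_sum, ← Finset.sum_add_distrib]
  rw [h]
  refine Finset.sum_le_sum fun i _ => ?_
  rw [Pi.add_apply]
  generalize a i = x
  generalize s i = y
  revert x y
  decide

theorem card_weight_eq_le (w : ℕ) :
    (Finset.univ.filter fun v : Fin n → ZMod 2 => weight v = w).card ≤ n.choose w := by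
  have h : n.choose w = (Finset.powersetCard w (Finset.univ : Finset (Fin n))).card := by
    simp
  rw [h]
  refine Finset.card_le_card_of_injOn (fun v => Finset.univ.filter fun i => v i ≠ 0) ?_ ?_
  · intro v hv
    simp only [Finset.coe_filter, Finset.mem_univ, true_and, Set.mem_ofPred_eq] at hv
    simpa [Finset.mem_powersetCard, weight] using hv
  · intro v _ v' _ he
    funext i
    have := Finset.ext_iff.1 he i
    simp only [Finset.mem_filter_univ] at this
    revert this
    generalize v i = x
    generalize v' i = y
    revert x y
    decide

theorem centralBinom_sq_mul_le (p : ℕ) : p.centralBinom ^ 2 * (2 * p + 1) ≤ 16 ^ p := by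
  induction p with
  | zero => simp
  | succ p ih =>
    have h := Nat.succ_mul_centralBinom_succ p
    refine le_of_mul_le_mul_left (a := (p + 1) ^ 2) ?_ (by positivity)
    calc (p + 1) ^ 2 * ((p + 1).centralBinom ^ 2 * (2 * (p + 1) + 1))
        = ((p + 1) * (p + 1).centralBinom) ^ 2 * (2 * p + 3) := by ring
      _ = (p.centralBinom ^ 2 * (2 * p + 1)) * (4 * ((2 * p + 1) * (2 * p + 3))) := by
        rw [h]; ring
      _ ≤ 16 ^ p * (4 * (4 * (p + 1) ^ 2)) := by
        refine Nat.mul_le_mul ih (Nat.mul_le_mul_left 4 ?_)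
        nlinarith
      _ = (p + 1) ^ 2 * 16 ^ (p + 1) := by ring

/-- The vectors of weight less than `(n - k) / 2`. -/
def lightVectors (n k : ℕ) : Set (Fin n → ZMod 2) := {v | 2 * weight v + k < n}

/-- The vectors of weight more than `(n + k) / 2`. -/
def heavyVectors (n k : ℕ) : Set (Fin n → ZMod 2) := {v | n + k < 2 * weight v}

/-- The remaining vectors lie in at most `2 * k + 1` middle layers, each no larger than the central
binomial coefficient. -/
theorem card_le_light_add_heavy (p k : ℕ) :
    2 ^ (2 * p) ≤ (lightVectors (2 * p) k).ncard + (heavyVectors (2 * p) k).ncard +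
      (2 * k + 1) * p.centralBinom := by
  classical
  let B := (Finset.Icc (p - k) (p + k)).biUnion fun w =>
    Finset.univ.filter fun v : Fin (2 * p) → ZMod 2 => weight v = w
  have hB : B.card ≤ (2 * k + 1) * p.centralBinom := by
    refine Finset.card_biUnion_le.trans ?_
    refine (Finset.sum_le_card_nsmul _ _ p.centralBinom fun w _ =>
      (card_weight_eq_le w).trans (Nat.choose_le_centralBinom w p)).trans ?_
    rw [Nat.card_Icc, smul_eq_mul]
    exact Nat.mul_le_mul_right _ (by omega)
  have hcov : (Set.univ : Set (Fin (2 * p) → ZMod 2)) ⊆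
      lightVectors (2 * p) k ∪ heavyVectors (2 * p) k ∪ B := by
    intro v _
    by_cases h1 : 2 * weight v + k < 2 * p
    · exact Or.inl (Or.inl h1)
    by_cases h2 : 2 * p + k < 2 * weight v
    · exact Or.inl (Or.inr h2)
    · refine Or.inr ?_
      simp only [B, Finset.coe_biUnion, Finset.coe_Icc, Set.mem_Icc, Finset.coe_filter,
        Finset.mem_univ, true_and, Set.mem_iUnion, Set.mem_ofPred_eq]
      exact ⟨_, by omega, rfl⟩
  have h := Set.ncard_le_ncard hcov (Set.toFinite _)
  have h1 := Set.ncard_union_le (lightVectors (2 * p) k ∪ heavyVectors (2 * p) k) (B : Set _)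
  have h2 := Set.ncard_union_le (lightVectors (2 * p) k) (heavyVectors (2 * p) k)
  rw [Set.ncard_coe_finset] at h1
  rw [Set.ncard_univ, Nat.card_eq_fintype_card, Fintype.card_fun, ZMod.card, Fintype.card_fin] at h
  omega

theorem exists_light_add_heavy_large (k : ℕ) {ε : ℝ} (hε : 0 < ε) :
    ∃ n : ℕ, (1 - ε) * 2 ^ n ≤ (lightVectors n k).ncard + (heavyVectors n k).ncard := by
  obtain ⟨p, hp⟩ := exists_nat_ge (((2 * k + 1) / ε) ^ 2)
  refine ⟨2 * p, ?_⟩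
  have h1 : ((2 : ℝ) ^ (2 * p)) ≤ (lightVectors (2 * p) k).ncard + (heavyVectors (2 * p) k).ncard +
      (2 * k + 1) * p.centralBinom := by exact_mod_cast card_le_light_add_heavy p k
  have h2 : (p.centralBinom : ℝ) ^ 2 * (2 * p + 1) ≤ 16 ^ p := by
    exact_mod_cast centralBinom_sq_mul_le p
  have h3 : (2 * k + 1) * (p.centralBinom : ℝ) ≤ ε * 2 ^ (2 * p) := by
    refine (pow_le_pow_iff_left₀ (by positivity) (by positivity) two_ne_zero).1 ?_
    rw [div_pow, div_le_iff₀ (by positivity)] at hp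
    have h16 : ((2 : ℝ) ^ (2 * p)) ^ 2 = 16 ^ p := by
      rw [← pow_mul, mul_right_comm, pow_mul]; norm_num
    calc ((2 * k + 1) * (p.centralBinom : ℝ)) ^ 2
        = (2 * k + 1) ^ 2 * (p.centralBinom : ℝ) ^ 2 := by ring
      _ ≤ (p * ε ^ 2) * (p.centralBinom : ℝ) ^ 2 := by gcongr
      _ ≤ ((2 * p + 1) * ε ^ 2) * (p.centralBinom : ℝ) ^ 2 := by
        gcongr
        have : (0 : ℝ) ≤ p := p.cast_nonneg
        linarith
      _ = ε ^ 2 * ((p.centralBinom : ℝ) ^ 2 * (2 * p + 1)) := by ring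
      _ ≤ ε ^ 2 * 16 ^ p := by gcongr
      _ = (ε * 2 ^ (2 * p)) ^ 2 := by rw [mul_pow, h16]
  linarith

end Weight

/-! ### Finite models -/

/-- `T` is supported on finitely many coordinates, and in a finite quotient of `G2` it is avoided by
the differences of a set of density more than `1 / 4`. -/
def HasModel (T : Set G2) : Prop :=
  ∃ (M : ℕ) (K : Type) (_ : AddCommGroup K) (_ : Fintype K) (π : G2 →+ K) (D : Set K) (c : ℝ),
    1 / 4 < c ∧ c * Fintype.card K ≤ D.ncard ∧ (∀ x : G2, (∀ j < M, x j = 0) → π x = 0) ∧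
      (∀ s ∈ T, ∀ j, M ≤ j → s j = 0) ∧ ∀ s ∈ T, ∀ x ∈ D, x + π s ∉ D

/-- The coordinates of an element of `G2` in the block `[M, M + n)`. -/
def blockProj (M n : ℕ) : G2 →+ (Fin n → ZMod 2) where
  toFun x i := x (M + i)
  map_zero' := rfl
  map_add' _ _ := rfl

theorem G2.add_self (g : G2) : g + g = 0 := by
  ext j
  exact CharTwo.add_self_eq_zero (g j)

theorem G2.exists_bound (g : G2) : ∃ B : ℕ, ∀ j, B ≤ j → g j = 0 := by
  classical
  refine ⟨(DFinsupp.support g).sup id + 1, fun j hj => ?_⟩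
  by_contra h
  have := Finset.le_sup (f := id) ((DFinsupp.mem_support_iff (f := g)).2 h)
  simp only [id] at this
  omega

theorem HasModel.extend {T : Set G2} (hT : HasModel T) {t : G2} (ht : t ∈ T) (g : G2) (k : ℕ) :
    ∃ T', T ⊆ T' ∧ HasModel T' ∧
      ∃ M n, ∀ v : Fin n → ZMod 2, n ≤ weight v + k → g + blockEmbed M n v ∈ T' := by
  obtain ⟨M₀, K, _, _, π, D, c, hc, hD, hπ, hsupp, hav⟩ := hT
  obtain ⟨B, hB⟩ := G2.exists_bound g
  -- The new block starts beyond the supports of `T` and `g`, so these vanish on it, and `π`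
  -- vanishes on the block.
  obtain ⟨M, hM₀, hMB⟩ : ∃ M, M₀ ≤ M ∧ B ≤ M := ⟨max M₀ B, le_max_left _ _, le_max_right _ _⟩
  -- With this `ε`, `c * (1 - ε) = (c + 1 / 4) / 2`, the new density bound.
  have hc' : 0 < (c - 1 / 4) / 2 / c := div_pos (by linarith) (by linarith)
  obtain ⟨n, hn⟩ := exists_light_add_heavy_large k hc'
  have hvan : ∀ s : G2, (∀ j, M ≤ j → s j = 0) → blockProj M n s = 0 := fun s hs =>
    funext fun i => hs _ (by omega)
  have hdisj : Disjoint (lightVectors n k) (heavyVectors n k) := by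
    rw [Set.disjoint_left]
    intro v h1 h2
    simp only [lightVectors, heavyVectors, Set.mem_ofPred_eq] at h1 h2
    omega
  set h := π g + π t with hh
  have hgg : π g + π g = 0 := by rw [← map_add, G2.add_self, map_zero]
  refine ⟨T ∪ {s | ∃ v : Fin n → ZMod 2, n ≤ weight v + k ∧ s = g + blockEmbed M n v},
    Set.subset_union_left, ?_, M, n, fun v hv => Or.inr ⟨v, hv, rfl⟩⟩
  refine ⟨M + n, K × (Fin n → ZMod 2), inferInstance, inferInstance, π.prod (blockProj M n),
    D ×ˢ lightVectors n k ∪ ((· + h) '' D) ×ˢ heavyVectors n k, (c + 1 / 4) / 2, by linarith,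
    ?_, ?_, ?_, ?_⟩
  · rw [Set.ncard_union_eq (Set.disjoint_prod.2 (Or.inr hdisj)) (Set.toFinite _) (Set.toFinite _),
      Set.ncard_prod, Set.ncard_prod, Set.ncard_image_of_injective _ (add_left_injective h),
      Fintype.card_prod, Fintype.card_fun, ZMod.card, Fintype.card_fin]
    push_cast
    have hc0 : c ≠ 0 := by linarith
    calc (c + 1 / 4) / 2 * (Fintype.card K * 2 ^ n)
        = (c * Fintype.card K) * ((1 - (c - 1 / 4) / 2 / c) * 2 ^ n) := by field_simp; ring
      _ ≤ (c * Fintype.card K) * ((lightVectors n k).ncard + (heavyVectors n k).ncard) := by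
        refine mul_le_mul_of_nonneg_left hn (mul_nonneg (by linarith) (Nat.cast_nonneg _))
      _ ≤ D.ncard * ((lightVectors n k).ncard + (heavyVectors n k).ncard) := by gcongr
      _ = _ := by ring
  · intro x hx
    refine Prod.ext (hπ x fun j hj => hx j (by omega)) ?_
    exact funext fun i => hx _ (by have := i.isLt; omega)
  · rintro s (hs | ⟨v, -, rfl⟩) j hj
    · exact hsupp s hs j (by omega)
    · rw [DirectSum.add_apply, hB j (by omega), blockEmbed_apply_of_le v hj, add_zero]
  · rintro s (hs | ⟨v, hv, rfl⟩) ⟨x, a⟩ hxa hxa'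
    · have h0 : blockProj M n s = 0 := hvan s fun j hj => hsupp s hs j (by omega)
      simp only [AddMonoidHom.prod_apply, Prod.mk_add_mk, h0, add_zero] at hxa'
      rcases hxa with ⟨hx, ha⟩ | ⟨⟨y, hy, rfl⟩, ha⟩ <;>
        rcases hxa' with ⟨hx', ha'⟩ | ⟨⟨y', hy', he⟩, ha'⟩
      · exact hav s hs x hx hx'
      · exact Set.disjoint_left.1 hdisj ha ha'
      · exact Set.disjoint_left.1 hdisj ha' ha
      · refine hav s hs y hy ?_
        have : y' = y + π s := by
          simp only at he
          rw [add_right_comm] at he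
          exact add_right_cancel he
        rwa [← this]
    -- A nearly full `v` must exchange light and heavy; in both directions the shift `h` turns `π g`
    -- into `π t`, and `t ∈ T` is already avoided.
    · have h1 : π (blockEmbed M n v) = 0 :=
        hπ _ fun j hj => blockEmbed_apply_of_lt v (by omega)
      have h2 : blockProj M n (g + blockEmbed M n v) = v := by
        rw [map_add, hvan g fun j hj => hB j (by omega), zero_add]
        exact funext fun i => blockEmbed_apply_add M n v i
      simp only [AddMonoidHom.prod_apply, Prod.mk_add_mk, h2, map_add π, h1, add_zero] at hxa'
      have hw1 := weight_le_add a v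
      have hw2 := weight_add_le_two_mul a v
      rcases hxa with ⟨hx, ha⟩ | ⟨⟨y, hy, rfl⟩, ha⟩ <;>
        rcases hxa' with ⟨hx', ha'⟩ | ⟨⟨y', hy', he⟩, ha'⟩ <;>
        simp only [lightVectors, heavyVectors, Set.mem_ofPred_eq] at ha ha'
      · omega
      · refine hav t ht y' hy' ?_
        have : y' + π t = x := by
          simp only [hh] at he
          rw [← add_assoc, add_right_comm] at he
          exact add_right_cancel he
        rwa [this]
      · refine hav t ht y hy ?_
        have : y + h + π g = y + π t + (π g + π g) := by rw [hh]; abel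
        simp only [this, hgg, add_zero] at hx'
        exact hx'
      · omega

theorem HasModel.singleton : HasModel {DirectSum.of (fun _ : ℕ => ZMod 2) 0 1} := by
  refine ⟨1, ZMod 2, inferInstance, inferInstance, ⟨⟨fun x => x 0, rfl⟩, fun _ _ => rfl⟩, {0},
    1 / 2, by norm_num, by simp, fun x hx => hx 0 one_pos, ?_, ?_⟩
  · rintro s rfl j hj
    exact DirectSum.of_eq_of_ne _ _ _ (by omega)
  · rintro s rfl x rfl h
    exact absurd h (by decide)

/-- Topological recurrence is asserted for systems in an arbitrary universe, and measurable
recurrence already fails for a system in the lowest one. -/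
theorem theorem1p1 :
    ∃ S : Set G2,
      (∀ g : G2, IsSetOfTopologicalRecurrence.{u} ((fun s : G2 => s + g) '' S)) ∧
        ¬ IsSetOfMeasurableRecurrence.{0} S := by
  classical
  set t : G2 := DirectSum.of (fun _ : ℕ => ZMod 2) 0 1
  have : Countable G2 := by
    refine Function.Surjective.countable (f := fun s : Finset ℕ =>
      ∑ i ∈ s, DirectSum.of (fun _ : ℕ => ZMod 2) i 1) fun g => ⟨DFinsupp.support g, ?_⟩
    conv_rhs => rw [← DirectSum.sum_support_of g]
    refine Finset.sum_congr rfl fun i hi => ?_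
    rw [DFinsupp.mem_support_iff] at hi
    congr 1
    exact (by decide : ∀ a : ZMod 2, a ≠ 0 → 1 = a) _ hi
  -- Every translate and every number of colours is treated at some stage.
  obtain ⟨e, he⟩ := exists_surjective_nat (G2 × ℕ)
  choose ext hext using fun (T : {T : Set G2 // HasModel T ∧ t ∈ T}) (i : ℕ) =>
    T.2.1.extend T.2.2 (e i).1 (e i).2
  let T : ℕ → {T : Set G2 // HasModel T ∧ t ∈ T} := fun i =>
    Nat.rec ⟨{t}, HasModel.singleton, rfl⟩
      (fun i T => ⟨ext T i, (hext T i).2.1, (hext T i).1 T.2.2⟩) i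
  have hT : ∀ i, (T (i + 1)).1 = ext (T i) i := fun i => rfl
  have hmono : ∀ i j, i ≤ j → (T i).1 ⊆ (T j).1 := by
    intro i j hij
    induction j, hij using Nat.le_induction with
    | base => exact subset_rfl
    | succ j _ ih => exact fun x hx => (hext (T j) j).1 (ih hx)
  refine ⟨⋃ i, (T i).1, fun g => isSetOfTopologicalRecurrence_of_coloring fun k f => ?_, ?_⟩
  · obtain ⟨i, hi⟩ := he (g, k)
    obtain ⟨-, -, M, n, hv⟩ := hext (T i) i
    rw [← hT, hi] at hv
    obtain ⟨x, v, hw, hf⟩ := exists_same_color_blockEmbed M n k f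
    refine ⟨x, _, ⟨g + blockEmbed M n v, Set.mem_iUnion.2 ⟨i + 1, hv v hw⟩, ?_⟩, hf⟩
    change g + blockEmbed M n v + g = _
    rw [add_right_comm, G2.add_self, zero_add]
  · refine not_isSetOfMeasurableRecurrence ⟨fun i => (T i).1, fun s hs => ?_, fun i => ?_⟩
    · obtain ⟨i, hi⟩ := Set.mem_iUnion.1 hs
      filter_upwards [Filter.eventually_ge_atTop i] with j hj
      exact hmono i j hj hi
    · obtain ⟨M, K, _, _, π, D, c, hc, hD, -, -, hav⟩ := (T i).2.1
      refine ⟨K, inferInstance, inferInstance, π, D, ?_, hav⟩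
      have h0 : (0 : ℝ) ≤ Fintype.card K := Nat.cast_nonneg _
      have : (Fintype.card K : ℝ) ≤ 4 * D.ncard := by nlinarith
      exact_mod_cast this
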